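/- Let $d \ge 1$ and let $C \subset \mathbb{R}^d$ be compact. The *bounded gaps* of $C$ are the bounded path-connected components of $\mathbb{R}^d \setminus C$, and the *unbounded gap* $E$ of $C$ is the union of the unbounded path-connected components of $\mathbb{R}^d \setminus C$. If $C$ has at least one bounded gap, the *thickness* of $C$ is $$\tau(C) := \inf_{G} \frac{\operatorname{dist}\Big(G,\; E \cup \bigcup \{H : H \ne G \text{ a bounded gap of } C,\ \operatorname{diam}(H) \ge \operatorname{diam}(G)\}\Big)}{\operatorname{diam}(G)},$$ where $G$ ranges over the bounded gaps of $C$; whenever the bounded gaps can be listed as $G_1, G_2, \dots$ by non-increasing diameter, this equals $\inf_n \operatorname{dist}\big(G_n, E \cup \bigcup_{i<n} G_i\big)/\operatorname{diam}(G_n)$. If $C$ has no bounded gap, then $\tau(C) := +\infty$ when $C$ has non-empty interior, and $\tau(C) := 0$ when $C$ has empty interior. In products of thicknesses, $0 \cdot \infty = 0$. **Corollary.** Let $d \ge 1$ and let $C_1, C_2 \subset \mathbb{R}^d$ be compact sets with $\tau(C_1)\,\tau(C_2) > 1$. Then for every $x \in C_1 \times C_2 \subset \mathbb{R}^{2d}$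 the pinned distance set $$\Delta_x(C_1 \times C_2) := \{\, |x - y| : y \in C_1 \times C_2 \,\} \subset \mathbb{R},$$ where $|\cdot|$ is the Euclidean norm on $\mathbb{R}^{2d}$, has non-empty interior in $\mathbb{R}$. -/

import Mathlib

open scoped ENNReal

/-- The bounded gaps of `C`: the bounded path-connected components of the complement of `C`. -/
def boundedGaps {d : ℕ} (C : Set (EuclideanSpace ℝ (Fin d))) :
    Set (Set (EuclideanSpace ℝ (Fin d))) :=
  {G | (∃ p ∈ Cᶜ, G = pathComponentIn Cᶜ p) ∧ Bornology.IsBounded G}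

/-- The unbounded gap `E` of `C`: the union of the unbounded path-connected components of the
complement of `C`. For compact `C` this is a single component if `d ≥ 2`, and the union of two
unbounded open intervals if `d = 1` and `C` is non-empty. -/
def unboundedGap {d : ℕ} (C : Set (EuclideanSpace ℝ (Fin d))) :
    Set (EuclideanSpace ℝ (Fin d)) :=
  {p | p ∈ Cᶜ ∧ ¬ Bornology.IsBounded (pathComponentIn Cᶜ p)}

/-- The distance `inf {|p - q| : p ∈ A, q ∈ B}` between two sets, as an extended nonnegative real. -/
noncomputable def setDist {d : ℕ} (A B : Set (EuclideanSpace ℝ (Fin d))) : ℝ≥0∞ :=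
  ⨅ p ∈ A, ⨅ q ∈ B, edist p q

/-- The infimum, over the bounded gaps `G` of `C`, of the distance from `G` to the union of the
unbounded gap and of the other bounded gaps of diameter at least `diam G`, divided by `diam G`.
The next lemma shows that it is the infimum of
`dist (G n, G 1 ∪ ... ∪ G (n - 1) ∪ E) / diam (G n)` for every enumeration `G 1, G 2, ...` of the
bounded gaps by non-increasing diameter. -/
noncomputable def gapRatioInf {d : ℕ} (C : Set (EuclideanSpace ℝ (Fin d))) : ℝ≥0∞ :=
  ⨅ G ∈ boundedGaps C,
    setDist G
      ((⋃ H ∈ {H ∈ boundedGaps C | H ≠ G ∧ Metric.ediam G ≤ Metric.ediam H}, H) ∪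
        unboundedGap C) / Metric.ediam G

/-- For every enumeration (finite or infinite) of the bounded gaps by non-increasing diameter,
`gapRatioInf` is given by comparing each gap with the earlier ones and the unbounded gap. -/
theorem gapRatioInf_eq_iInf_enumeration {d : ℕ} (hd : 1 ≤ d)
    (C : Set (EuclideanSpace ℝ (Fin d))) (hC : IsCompact C)
    (s : Set ℕ) (G : ℕ → Set (EuclideanSpace ℝ (Fin d)))
    (hG : Set.BijOn G s (boundedGaps C))
    (hdiam : ∀ i ∈ s, ∀ j ∈ s, i ≤ j → Metric.ediam (G j) ≤ Metric.ediam (G i)) :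
    gapRatioInf C =
      ⨅ n ∈ s, setDist (G n) ((⋃ i ∈ {i ∈ s | i < n}, G i) ∪ unboundedGap C) /
        Metric.ediam (G n) := by
  have hanti : ∀ A B B' : Set (EuclideanSpace ℝ (Fin d)), B ⊆ B' → setDist A B' ≤ setDist A B :=
    fun A B B' h => iInf₂_mono fun p _ => biInf_mono h
  apply le_antisymm
  · refine le_iInf₂ fun n hn => (iInf₂_le (G n) (hG.mapsTo hn)).trans ?_
    refine ENNReal.div_le_div_right (hanti _ _ _ ?_) _
    refine Set.union_subset_union_left _ (Set.iUnion₂_subset fun i hi => ?_)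
    refine Set.subset_biUnion_of_mem (u := fun H => H) ?_
    exact ⟨hG.mapsTo hi.1, fun h => hi.2.ne (hG.injOn hi.1 hn h), hdiam i hi.1 n hn hi.2.le⟩
  · refine le_iInf₂ fun A hA => ?_
    obtain ⟨n, hn, rfl⟩ := hG.surjOn hA
    have h0 : Metric.ediam (G n) ≠ ⊤ := Metric.isBounded_iff_ediam_ne_top.1 hA.2
    have hne : Metric.ediam (G n) ≠ 0 := by
      obtain ⟨⟨p, hp, hGp⟩, -⟩ := hA
      have : Nonempty (Fin d) := ⟨⟨0, hd⟩⟩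
      rw [hGp, Ne, Metric.ediam_eq_zero_iff]
      intro hsub
      have hnhds : pathComponentIn Cᶜ p ∈ nhds p :=
        (hC.isClosed.isOpen_compl.pathComponentIn p).mem_nhds (mem_pathComponentIn_self hp)
      exact (infinite_of_mem_nhds p hnhds) hsub.finite
    -- it suffices to bound the ratio for each pair of points
    have key : ∀ p ∈ G n, ∀ q ∈ ((⋃ H ∈ {H ∈ boundedGaps C | H ≠ G n ∧
        Metric.ediam (G n) ≤ Metric.ediam H}, H) ∪ unboundedGap C),
        (⨅ n ∈ s, setDist (G n) ((⋃ i ∈ {i ∈ s | i < n}, G i) ∪ unboundedGap C) /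
          Metric.ediam (G n)) ≤ edist p q / Metric.ediam (G n) := by
      intro p hp q hq
      have hle : ∀ m ∈ s, ∀ p ∈ G m, ∀ q ∈ ((⋃ i ∈ {i ∈ s | i < m}, G i) ∪ unboundedGap C),
          (⨅ n ∈ s, setDist (G n) ((⋃ i ∈ {i ∈ s | i < n}, G i) ∪ unboundedGap C) /
            Metric.ediam (G n)) ≤ edist p q / Metric.ediam (G m) := fun m hm p hp q hq =>
        (iInf₂_le m hm).trans (ENNReal.div_le_div_right
          ((iInf₂_le p hp).trans (iInf₂_le q hq)) _)
      rcases hq with hq | hq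
      · obtain ⟨H, ⟨hH, hHn, hHd⟩, hqH⟩ := Set.mem_iUnion₂.1 hq
        obtain ⟨m, hm, rfl⟩ := hG.surjOn hH
        rcases lt_trichotomy m n with h | h | h
        · exact hle n hn p hp q (Or.inl (Set.mem_iUnion₂.2 ⟨m, ⟨hm, h⟩, hqH⟩))
        · exact absurd (h ▸ rfl) hHn
        · have := hle m hm q hqH p (Or.inl (Set.mem_iUnion₂.2 ⟨n, ⟨hn, h⟩, hp⟩))
          rwa [edist_comm, le_antisymm (hdiam n hn m hm h.le) hHd] at this
      · exact hle n hn p hp q (Or.inr hq)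
    rw [ENNReal.le_div_iff_mul_le (Or.inl hne) (Or.inl h0)]
    refine le_iInf₂ fun p hp => le_iInf₂ fun q hq => ?_
    rw [← ENNReal.le_div_iff_mul_le (Or.inl hne) (Or.inl h0)]
    exact key p hp q hq

open Classical in
/-- The thickness `τ(C) ∈ [0, ∞]` of a compact set `C`. -/
noncomputable def thickness {d : ℕ} (C : Set (EuclideanSpace ℝ (Fin d))) : ℝ≥0∞ :=
  if (boundedGaps C).Nonempty then gapRatioInf C
  else if (interior C).Nonempty then ⊤ else 0

/-- The product `A × B ⊆ ℝ^d × ℝ^d = ℝ^(2d)`, where `ℝ^d × ℝ^d` carries the Euclidean norm. -/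
def euclideanProd {d : ℕ} (A B : Set (EuclideanSpace ℝ (Fin d))) :
    Set (WithLp 2 (EuclideanSpace ℝ (Fin d) × EuclideanSpace ℝ (Fin d))) :=
  {z | z.fst ∈ A ∧ z.snd ∈ B}

/-- The pinned distance set `Δ_x(C) = {|x - y| : y ∈ C}`. -/
def pinnedDistanceSet {X : Type*} [NormedAddCommGroup X] (x : X) (C : Set X) : Set ℝ :=
  {t | ∃ y ∈ C, t = ‖x - y‖}

/-! If some factor has interior, moving one coordinate radially already gives an interval of
distances. Otherwise both factors have bounded gaps and positive thickness, and the dimension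
decides.

For `d ≥ 2` one factor suffices: a sphere about `x` slightly larger than the farthest reach of a gap
`G` must meet `C`. If not, it would lie in one complementary component, either unbounded or of
diameter at least that of `G`, and too close to `G`.

For `d = 1` the squared distance is a sum `(y₁ - x₁)² + (y₂ - x₂)²`, so it is enough that a sumset
contains an interval. On a short piece away from `x`, squaring the distance is nearly a similarity
and costs arbitrarily little thickness (`IsThick.exists_subset_sq_sub`); the strict inequality on
the product pays for it. Newhouse's gap lemma (`IsThick.inter_nonempty`), applied to `T - L₁` and
`L₂`, then gives the interval. `IsThick` is the symmetric real-line form of thickness, free of any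
enumeration of gaps. -/

/-! ### Gaps and thickness of sets of reals. -/

/-- `(a, b)` is a bounded gap of the set `K` of reals. -/
structure IsRealGap (K : Set ℝ) (a b : ℝ) : Prop where
  lt : a < b
  left_mem : a ∈ K
  right_mem : b ∈ K
  le_or_le : ∀ z ∈ K, z ≤ a ∨ b ≤ z

/-- Two gaps of `K` are at distance at least `τ` times the smaller length, and the bounded gaps
are at distance at least `τ` times their length from both ends of `K`. -/
structure IsThick (K : Set ℝ) (τ : ℝ) : Prop where
  sep : ∀ a b c e, IsRealGap K a b → IsRealGap K c e → b ≤ c → τ * min (b - a) (e - c) ≤ c - b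
  left : ∀ a b, IsRealGap K a b → ∃ z ∈ K, z ≤ a - τ * (b - a)
  right : ∀ a b, IsRealGap K a b → ∃ z ∈ K, b + τ * (b - a) ≤ z

theorem IsRealGap.of_neg {K : Set ℝ} {a b : ℝ} (h : IsRealGap (Neg.neg '' K) a b) :
    IsRealGap K (-b) (-a) := by
  obtain ⟨h1, ⟨u, hu, rfl⟩, ⟨v, hv, rfl⟩, h4⟩ := h
  refine ⟨by linarith, by simpa using hv, by simpa using hu, fun z hz => ?_⟩
  rcases h4 (-z) ⟨z, hz, rfl⟩ with h | h
  · right; linarith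
  · left; linarith

theorem IsRealGap.neg {K : Set ℝ} {a b : ℝ} (h : IsRealGap K a b) :
    IsRealGap (Neg.neg '' K) (-b) (-a) := by
  refine ⟨by linarith [h.lt], ⟨b, h.right_mem, rfl⟩, ⟨a, h.left_mem, rfl⟩, ?_⟩
  rintro _ ⟨z, hz, rfl⟩
  rcases h.le_or_le z hz with h | h
  · right; linarith
  · left; linarith

theorem IsThick.neg {K : Set ℝ} {τ : ℝ} (h : IsThick K τ) : IsThick (Neg.neg '' K) τ := by
  refine ⟨fun a b c e hab hce hbc => ?_, fun a b hab => ?_, fun a b hab => ?_⟩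
  · have := h.sep _ _ _ _ hce.of_neg hab.of_neg (by linarith)
    rw [min_comm, neg_sub_neg, neg_sub_neg, neg_sub_neg] at this
    exact this
  · obtain ⟨z, hz, hz'⟩ := h.right _ _ hab.of_neg
    exact ⟨-z, ⟨z, hz, rfl⟩, by linarith⟩
  · obtain ⟨z, hz, hz'⟩ := h.left _ _ hab.of_neg
    exact ⟨-z, ⟨z, hz, rfl⟩, by linarith⟩

/-- Thickness under an increasing bi-Lipschitz map. -/
theorem IsThick.image {K : Set ℝ} {τ τ' m M : ℝ} (h : IsThick K τ) (hm : 0 < m)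
    (hτ' : 0 ≤ τ') (hM : M * τ' ≤ m * τ) (φ : ℝ → ℝ)
    (hl : ∀ u ∈ K, ∀ v ∈ K, u ≤ v → m * (v - u) ≤ φ v - φ u)
    (hu : ∀ u ∈ K, ∀ v ∈ K, u ≤ v → φ v - φ u ≤ M * (v - u)) :
    IsThick (φ '' K) τ' := by
  have lt_of : ∀ u ∈ K, ∀ v ∈ K, φ u < φ v → u < v := by
    intro u hu' v hv huv
    by_contra! hcon
    nlinarith [hl v hv u hu' hcon]
  have le_of : ∀ u ∈ K, ∀ v ∈ K, φ u ≤ φ v → u ≤ v := by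
    intro u hu' v hv huv
    by_contra! hcon
    nlinarith [hl v hv u hu' hcon.le]
  have gap : ∀ u ∈ K, ∀ v ∈ K, IsRealGap (φ '' K) (φ u) (φ v) → IsRealGap K u v := by
    intro u hu' v hv hg
    refine ⟨lt_of u hu' v hv hg.lt, hu', hv, fun z hz => ?_⟩
    exact (hg.le_or_le _ ⟨z, hz, rfl⟩).imp (le_of z hz u hu') (le_of v hv z hz)
  have key : ∀ u ∈ K, ∀ v ∈ K, u ≤ v → τ' * (φ v - φ u) ≤ m * (τ * (v - u)) := by
    intro u hu' v hv huv
    nlinarith [mul_le_mul_of_nonneg_left (hu u hu' v hv huv) hτ',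
      mul_le_mul_of_nonneg_right hM (sub_nonneg.2 huv)]
  refine ⟨fun a b c e hab hce hbc => ?_, fun a b hab => ?_, fun a b hab => ?_⟩
  · obtain ⟨a, ha, rfl⟩ := hab.left_mem
    obtain ⟨b, hb, rfl⟩ := hab.right_mem
    obtain ⟨c, hc, rfl⟩ := hce.left_mem
    obtain ⟨e, he, rfl⟩ := hce.right_mem
    have hab' := gap _ ha _ hb hab
    have hce' := gap _ hc _ he hce
    have hbc' := le_of _ hb _ hc hbc
    have h1 := h.sep _ _ _ _ hab' hce' hbc'
    refine le_trans ?_ (hl _ hb _ hc hbc')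
    refine le_trans ?_ (mul_le_mul_of_nonneg_left h1 hm.le)
    rcases le_total (b - a) (e - c) with hh | hh
    · rw [min_eq_left hh]
      exact (mul_le_mul_of_nonneg_left (min_le_left _ _) hτ').trans (key _ ha _ hb hab'.lt.le)
    · rw [min_eq_right hh]
      exact (mul_le_mul_of_nonneg_left (min_le_right _ _) hτ').trans (key _ hc _ he hce'.lt.le)
  · obtain ⟨a, ha, rfl⟩ := hab.left_mem
    obtain ⟨b, hb, rfl⟩ := hab.right_mem
    have hab' := gap _ ha _ hb hab
    obtain ⟨z, hz, hz'⟩ := h.left _ _ hab'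
    refine ⟨φ z, ⟨z, hz, rfl⟩, ?_⟩
    have h1 := key _ ha _ hb hab'.lt.le
    -- The sign of `τ` is not assumed; it is recovered here to place `z` to the left of `a`, as `hl`
    -- requires.
    have h2 : 0 ≤ m * (τ * (b - a)) :=
      (mul_nonneg hτ' (sub_nonneg.2 hab.lt.le)).trans h1
    have h3 : 0 ≤ τ * (b - a) := nonneg_of_mul_nonneg_right h2 hm
    have h4 := hl _ hz _ ha (by linarith)
    have h5 := mul_le_mul_of_nonneg_left (show τ * (b - a) ≤ a - z by linarith) hm.le
    linarith
  · obtain ⟨a, ha, rfl⟩ := hab.left_mem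
    obtain ⟨b, hb, rfl⟩ := hab.right_mem
    have hab' := gap _ ha _ hb hab
    obtain ⟨z, hz, hz'⟩ := h.right _ _ hab'
    refine ⟨φ z, ⟨z, hz, rfl⟩, ?_⟩
    have h1 := key _ ha _ hb hab'.lt.le
    have h2 : 0 ≤ m * (τ * (b - a)) :=
      (mul_nonneg hτ' (sub_nonneg.2 hab.lt.le)).trans h1
    have h3 : 0 ≤ τ * (b - a) := nonneg_of_mul_nonneg_right h2 hm
    have h4 := hl _ hb _ hz (by linarith)
    have h5 := mul_le_mul_of_nonneg_left (show τ * (b - a) ≤ z - b by linarith) hm.le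
    linarith

/-! ### The gap lemma and sumsets. -/

theorem exists_isRealGap {K : Set ℝ} (hK : IsCompact K) {u y v : ℝ} (hu : u ∈ K) (hv : v ∈ K)
    (hy : y ∉ K) (huy : u ≤ y) (hyv : y ≤ v) :
    ∃ a b, IsRealGap K a b ∧ u ≤ a ∧ a < y ∧ y < b ∧ b ≤ v := by
  obtain ⟨a, ⟨haK, hay⟩, ha⟩ := (hK.inter_right (isClosed_Iic (a := y))).exists_isGreatest
    ⟨u, hu, huy⟩
  obtain ⟨b, ⟨hbK, hyb⟩, hb⟩ := (hK.inter_right (isClosed_Ici (a := y))).exists_isLeast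
    ⟨v, hv, hyv⟩
  have hay' : a < y := lt_of_le_of_ne hay fun h => hy (h ▸ haK)
  have hyb' : y < b := lt_of_le_of_ne hyb fun h => hy (h ▸ hbK)
  refine ⟨a, b, ⟨hay'.trans hyb', haK, hbK, fun z hz => ?_⟩, ha ⟨hu, huy⟩, hay', hyb',
    hb ⟨hv, hyv⟩⟩
  exact (le_total z y).imp (fun h => ha ⟨hz, h⟩) (fun h => hb ⟨hz, h⟩)

/-- Two disjoint compact sets of reals with linked gaps have linked gaps, in the other order,
of smaller total length. -/
theorem IsThick.exists_smaller_linked {K₁ K₂ : Set ℝ} {τ₁ τ₂ : ℝ} (hK₁ : IsCompact K₁)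
    (hK₂ : IsCompact K₂) (h₁ : IsThick K₁ τ₁) (h₂ : IsThick K₂ τ₂) (hτ₂ : 0 < τ₂)
    (hτ : 1 < τ₁ * τ₂) (hdisj : Disjoint K₁ K₂) {a b c e : ℝ}
    (hab : IsRealGap K₁ a b) (hce : IsRealGap K₂ c e) (hac : a < c) (hcb : c < b) (hbe : b < e) :
    ∃ c' e' a' b', IsRealGap K₂ c' e' ∧ IsRealGap K₁ a' b' ∧ c' < a' ∧ a' < e' ∧ e' < b' ∧
      (e' - c') + (b' - a') < (b - a) + (e - c) := by
  have hdisj' := Set.disjoint_left.1 hdisj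
  -- In this case `K₁` reaches past `e`, so `e` lies in a gap of `K₁`. It is separated from `(a, b)`
  -- by less than `τ₁ * (b - a)`, hence is shorter than `(a, b)` and can replace it.
  by_cases hcase : e - b < τ₁ * (b - a)
  · obtain ⟨z, hz, hz'⟩ := h₁.right _ _ hab
    obtain ⟨a', b', hg, hba, hae, heb, -⟩ := exists_isRealGap hK₁ hab.right_mem hz
      (fun h => hdisj' h hce.right_mem) hbe.le (by linarith : e ≤ z)
    refine ⟨c, e, a', b', hce, hg, by linarith, hae, heb, ?_⟩
    have h3 := h₁.sep _ _ _ _ hab hg hba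
    by_contra! hcon
    rw [min_eq_left (by linarith)] at h3
    linarith
  -- If both cases failed, then `τ₁ * (b - a) < e - c` and `τ₂ * (e - c) < b - a`, against `1 < τ₁ *
  -- τ₂`. So the mirror argument applies, replacing `(c, e)` by a shorter gap around `a`.
  · have hcase2 : c - a < τ₂ * (e - c) := by
      by_contra! hcon
      have h3 : 0 < b - a := by linarith
      have h4 : 0 < e - c := by linarith
      have h5 : τ₁ * (b - a) < e - c := by linarith
      have h6 : τ₂ * (e - c) < b - a := by linarith
      have h7 := mul_lt_mul_of_pos_left h5 hτ₂
      nlinarith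
    obtain ⟨z, hz, hz'⟩ := h₂.left _ _ hce
    obtain ⟨c', e', hg, -, hca, hae, hec⟩ := exists_isRealGap hK₂ hz hce.left_mem
      (fun h => hdisj' hab.left_mem h) (by linarith : z ≤ a) hac.le
    refine ⟨c', e', a, b, hg, hab, hca, hae, by linarith, ?_⟩
    have h3 := h₂.sep _ _ _ _ hg hce hec
    by_contra! hcon
    rw [min_eq_right (by linarith)] at h3
    linarith

theorem isClosed_setOf_le_or_le {X : Type*} [TopologicalSpace X] (K : Set ℝ) {f g : X → ℝ}
    (hf : Continuous f) (hg : Continuous g) :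
    IsClosed {p | ∀ z ∈ K, z ≤ f p ∨ g p ≤ z} := by
  simp only [Set.ofPred_forall, Set.ofPred_or]
  exact isClosed_iInter fun z => isClosed_iInter fun _ =>
    (isClosed_le continuous_const hf).union (isClosed_le hg continuous_const)

/-- The gap lemma: two thick compact sets of reals with interleaved convex hulls intersect. -/
theorem IsThick.inter_nonempty {K₁ K₂ : Set ℝ} {τ₁ τ₂ : ℝ} (hK₁ : IsCompact K₁)
    (hK₂ : IsCompact K₂) (h₁ : IsThick K₁ τ₁) (h₂ : IsThick K₂ τ₂) (hτ₁ : 0 < τ₁)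
    (hτ₂ : 0 < τ₂) (hτ : 1 < τ₁ * τ₂) {p₁ q₁ p₂ q₂ : ℝ} (hp₁ : p₁ ∈ K₁) (hq₁ : IsGreatest K₁ q₁)
    (hp₂ : IsLeast K₂ p₂) (hq₂ : q₂ ∈ K₂) (h12 : p₁ < p₂) (h21 : p₂ < q₁) (h22 : q₁ < q₂) :
    (K₁ ∩ K₂).Nonempty := by
  rw [← Set.not_disjoint_iff_nonempty_inter]
  intro hdisj
  have hdisj' := Set.disjoint_left.1 hdisj
  obtain ⟨c, e, hce, hpc, hcq, hqe, -⟩ := exists_isRealGap hK₂ hp₂.1 hq₂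
    (hdisj' hq₁.1) h21.le h22.le
  obtain ⟨a, b, hab, -, hac, hcb, hbq⟩ := exists_isRealGap hK₁ hp₁ hq₁.1
    (fun h => hdisj' h hce.left_mem) (by linarith) hcq.le
  -- Weak inequalities make the set of linked pairs compact, so a pair of least total length exists;
  -- disjointness makes its inequalities strict again.
  let S : Set ((ℝ × ℝ) × ℝ × ℝ) := ((K₁ ×ˢ K₁) ×ˢ (K₂ ×ˢ K₂)) ∩
    ({p | p.1.1 ≤ p.2.1} ∩ {p | p.2.1 ≤ p.1.2} ∩ {p | p.1.2 ≤ p.2.2} ∩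
      {p | ∀ z ∈ K₁, z ≤ p.1.1 ∨ p.1.2 ≤ z} ∩ {p | ∀ z ∈ K₂, z ≤ p.2.1 ∨ p.2.2 ≤ z})
  have hS : IsCompact S := by
    refine ((hK₁.prod hK₁).prod (hK₂.prod hK₂)).inter_right ?_
    refine ((((isClosed_le ?_ ?_).inter (isClosed_le ?_ ?_)).inter
      (isClosed_le ?_ ?_)).inter (isClosed_setOf_le_or_le _ ?_ ?_)).inter
      (isClosed_setOf_le_or_le _ ?_ ?_) <;> fun_prop
  obtain ⟨⟨⟨a, b⟩, c, e⟩, ⟨⟨⟨haK, hbK⟩, hcK, heK⟩, ⟨⟨⟨hac, hcb⟩, hbe⟩, h1⟩, h2⟩, hmin⟩ :=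
    hS.exists_isMinOn (f := fun p => (p.1.2 - p.1.1) + (p.2.2 - p.2.1))
      ⟨((a, b), (c, e)), ⟨⟨hab.left_mem, hab.right_mem⟩, hce.left_mem, hce.right_mem⟩,
        ⟨⟨⟨hac.le, hcb.le⟩, by simpa using by linarith⟩, hab.le_or_le⟩, hce.le_or_le⟩
      (by fun_prop)
  simp only [Set.mem_ofPred_eq] at hac hcb hbe h1 h2 haK hbK hcK heK
  have ne : ∀ u ∈ K₁, ∀ v ∈ K₂, u ≠ v := fun u hu v hv h => hdisj' hu (h ▸ hv)
  have hac' := lt_of_le_of_ne hac (ne _ haK _ hcK)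
  have hcb' := lt_of_le_of_ne hcb (ne _ hbK _ hcK).symm
  have hbe' := lt_of_le_of_ne hbe (ne _ hbK _ heK)
  obtain ⟨c', e', a', b', hce', hab', k1, k2, k3, k4⟩ := h₁.exists_smaller_linked hK₁ hK₂ h₂
    hτ₂ hτ hdisj ⟨hac'.trans hcb', haK, hbK, h1⟩ ⟨hcb'.trans hbe', hcK, heK, h2⟩
    hac' hcb' hbe'
  -- Each replacement swaps the order of linking, so a second one is needed to return to `S` and
  -- contradict minimality.
  obtain ⟨a'', b'', c'', e'', hab'', hce'', l1, l2, l3, l4⟩ := h₂.exists_smaller_linked hK₂ hK₁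
    h₁ hτ₁ (by linarith) hdisj.symm hce' hab' k1 k2 k3
  have := hmin (show ((a'', b''), (c'', e'')) ∈ S from
    ⟨⟨⟨hab''.left_mem, hab''.right_mem⟩, hce''.left_mem, hce''.right_mem⟩,
        ⟨⟨⟨l1.le, l2.le⟩, l3.le⟩, hab''.le_or_le⟩, hce''.le_or_le⟩)
  simp only [Set.mem_ofPred_eq] at this
  linarith

/-- The sumset of two thick sets with thickness product greater than one contains an interval. -/
theorem IsThick.exists_Ioo_subset_add {L₁ L₂ : Set ℝ} {τ₁ τ₂ : ℝ} (hL₁ : IsCompact L₁)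
    (hL₂ : IsCompact L₂) (n₁ : L₁.Nontrivial) (n₂ : L₂.Nontrivial) (h₁ : IsThick L₁ τ₁)
    (h₂ : IsThick L₂ τ₂) (hτ₁ : 0 < τ₁) (hτ₂ : 0 < τ₂) (hτ : 1 < τ₁ * τ₂) :
    ∃ l r, l < r ∧ ∀ T ∈ Set.Ioo l r, ∃ u ∈ L₁, ∃ v ∈ L₂, u + v = T := by
  have ends : ∀ L : Set ℝ, IsCompact L → L.Nontrivial →
      ∃ p q, IsLeast L p ∧ IsGreatest L q ∧ p < q := by
    intro L hL hn
    obtain ⟨p, hp⟩ := hL.exists_isLeast hn.nonempty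
    obtain ⟨q, hq⟩ := hL.exists_isGreatest hn.nonempty
    obtain ⟨u, hu, v, hv, huv⟩ := hn.exists_lt
    exact ⟨p, q, hp, hq, by linarith [hp.2 hu, hq.2 hv]⟩
  obtain ⟨p₁, q₁, hp₁, hq₁, h1⟩ := ends _ hL₁ n₁
  obtain ⟨p₂, q₂, hp₂, hq₂, h2⟩ := ends _ hL₂ n₂
  -- These bounds on `T` say exactly that `T - q₁ < p₂ < T - p₁ < q₂`: the hulls of `T - L₁` and
  -- `L₂` interleave.
  refine ⟨p₁ + p₂, min (p₁ + q₂) (q₁ + p₂), lt_min (by linarith) (by linarith), ?_⟩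
  rintro T ⟨hT1, hT2⟩
  obtain ⟨hT3, hT4⟩ := lt_min_iff.1 hT2
  have hthick : IsThick ((fun y => T + y) '' (Neg.neg '' L₁)) τ₁ :=
    h₁.neg.image (m := 1) (M := 1) one_pos hτ₁.le le_rfl _
      (fun u _ v _ _ => by linarith) (fun u _ v _ _ => by linarith)
  have hcomp : IsCompact ((fun y => T + y) '' (Neg.neg '' L₁)) :=
    (hL₁.image continuous_neg).image (by fun_prop)
  have hgr : IsGreatest ((fun y => T + y) '' (Neg.neg '' L₁)) (T + -p₁) := by
    refine ⟨⟨_, ⟨_, hp₁.1, rfl⟩, rfl⟩, ?_⟩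
    rintro _ ⟨_, ⟨u, hu, rfl⟩, rfl⟩
    have := hp₁.2 hu
    simp only
    linarith
  obtain ⟨y, ⟨_, ⟨u, hu, rfl⟩, rfl⟩, hv⟩ := hthick.inter_nonempty hcomp hL₂ h₂ hτ₁ hτ₂ hτ
    (p₁ := T + -q₁) ⟨_, ⟨_, hq₁.1, rfl⟩, rfl⟩ hgr hp₂ hq₂.1 (by linarith) (by linarith)
    (by linarith)
  exact ⟨u, hu, _, hv, by simp⟩

/-! ### Small thick pieces and squared distances. -/

theorem exists_isRealGap_of_interior_eq_empty {K : Set ℝ} (hK : IsCompact K)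
    (hint : interior K = ∅) {u v : ℝ} (hu : u ∈ K) (hv : v ∈ K) (huv : u < v) :
    ∃ a b, IsRealGap K a b ∧ u ≤ a ∧ b ≤ v := by
  have : ∃ y ∈ Set.Ioo u v, y ∉ K := by
    by_contra! hcon
    have := interior_maximal (show Set.Ioo u v ⊆ K from hcon) isOpen_Ioo
    rw [hint] at this
    exact this (show (u + v) / 2 ∈ Set.Ioo u v from ⟨by linarith, by linarith⟩)
  obtain ⟨y, hy, hyK⟩ := this
  obtain ⟨a, b, hg, h1, -, -, h2⟩ := exists_isRealGap hK hu hv hyK hy.1.le hy.2.le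
  exact ⟨a, b, hg, h1, h2⟩

/-- The left end of a gap is not isolated in a thick set. -/
theorem IsThick.exists_mem_Ioo_left {K : Set ℝ} {τ : ℝ} (hK : IsCompact K) (h : IsThick K τ)
    (hτ : 0 < τ) {a b : ℝ} (hab : IsRealGap K a b) {ε : ℝ} (hε : 0 < ε) :
    ∃ z ∈ K, a - ε < z ∧ z < a := by
  by_contra! hcon
  obtain ⟨z, hz, hza⟩ := h.left _ _ hab
  have hpos : 0 < τ * (b - a) := mul_pos hτ (by linarith [hab.lt])
  have hz1 : z ≤ a - ε := by
    by_contra! hlt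
    linarith [hcon z hz hlt]
  have hy : a - ε / 2 ∉ K := fun hmem => by linarith [hcon _ hmem (by linarith)]
  -- Were `a` isolated on the left, this gap would end at `a`, at distance zero from `(a, b)`.
  obtain ⟨a', b', hg, -, -, h1, h2⟩ := exists_isRealGap hK hz hab.left_mem hy (by linarith)
    (by linarith)
  have h3 := hcon b' hg.right_mem (by linarith)
  have h4 := h.sep _ _ _ _ hg hab h2
  have h5 : 0 < min (b' - a') (b - a) := lt_min (by linarith [hg.lt]) (by linarith [hab.lt])
  have := mul_pos hτ h5
  linarith

/-- A thick set is thick between two suitable gaps in a given interval. -/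
theorem IsThick.exists_piece_of_gaps {K : Set ℝ} {τ : ℝ} (hK : IsCompact K) (h : IsThick K τ)
    (hτ : 0 < τ) {l r a b c e : ℝ} (hab : IsRealGap K a b) (hce : IsRealGap K c e)
    (hla : l ≤ a) (hbc : b ≤ c) (her : e ≤ r) :
    ∃ L ⊆ K ∩ Set.Icc l r, IsCompact L ∧ L.Nontrivial ∧ IsThick L τ := by
  -- The two bounding gaps maximise the product of their lengths. A gap between them may replace
  -- either one, so it is no longer than either, and `sep` then keeps it away from both ends of the
  -- piece. The product, unlike the sum, excludes a degenerate maximiser.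
  let S : Set ((ℝ × ℝ) × ℝ × ℝ) := ((K ×ˢ K) ×ˢ (K ×ˢ K)) ∩
    ({p | l ≤ p.1.1} ∩ {p | p.1.1 ≤ p.1.2} ∩ {p | p.1.2 ≤ p.2.1} ∩ {p | p.2.1 ≤ p.2.2} ∩
      {p | p.2.2 ≤ r} ∩
      {p | ∀ z ∈ K, z ≤ p.1.1 ∨ p.1.2 ≤ z} ∩ {p | ∀ z ∈ K, z ≤ p.2.1 ∨ p.2.2 ≤ z})
  have hS : IsCompact S := by
    refine ((hK.prod hK).prod (hK.prod hK)).inter_right ?_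
    refine ((((((isClosed_le ?_ ?_).inter (isClosed_le ?_ ?_)).inter
      (isClosed_le ?_ ?_)).inter (isClosed_le ?_ ?_)).inter (isClosed_le ?_ ?_)).inter
      (isClosed_setOf_le_or_le _ ?_ ?_)).inter
      (isClosed_setOf_le_or_le _ ?_ ?_) <;> fun_prop
  have hmem : ∀ {a b c e}, IsRealGap K a b → IsRealGap K c e → l ≤ a → b ≤ c → e ≤ r →
      ((a, b), (c, e)) ∈ S := fun hab hce hla hbc her =>
    ⟨⟨⟨hab.left_mem, hab.right_mem⟩, hce.left_mem, hce.right_mem⟩,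
      ⟨⟨⟨⟨⟨hla, hab.lt.le⟩, hbc⟩, hce.lt.le⟩, her⟩, hab.le_or_le⟩, hce.le_or_le⟩
  obtain ⟨⟨⟨a', b'⟩, c', e'⟩, ⟨⟨⟨haK, hbK⟩, hcK, heK⟩,
      ⟨⟨⟨⟨⟨hla', hab'⟩, hbc'⟩, hce'⟩, her'⟩, h1⟩, h2⟩, hmax⟩ :=
    hS.exists_isMaxOn (f := fun p => (p.1.2 - p.1.1) * (p.2.2 - p.2.1))
      ⟨_, hmem hab hce hla hbc her⟩ (by fun_prop)
  simp only [Set.mem_ofPred_eq] at haK hbK hcK heK hla' hab' hbc' hce' her' h1 h2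
  have hmax' : ∀ {a b c e}, IsRealGap K a b → IsRealGap K c e → l ≤ a → b ≤ c → e ≤ r →
      (b - a) * (e - c) ≤ (b' - a') * (e' - c') := fun hab hce hla hbc her =>
    hmax (hmem hab hce hla hbc her)
  have hpos : 0 < (b' - a') * (e' - c') :=
    (mul_pos (sub_pos.2 hab.lt) (sub_pos.2 hce.lt)).trans_le (hmax' hab hce hla hbc her)
  have hU : 0 < b' - a' := pos_of_mul_pos_left hpos (by linarith)
  have hV : 0 < e' - c' := pos_of_mul_pos_right hpos (by linarith)
  have gU : IsRealGap K a' b' := ⟨by linarith, haK, hbK, h1⟩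
  have gV : IsRealGap K c' e' := ⟨by linarith, hcK, heK, h2⟩
  have hlt : b' < c' := by
    have := h.sep _ _ _ _ gU gV hbc'
    have := mul_pos hτ (lt_min hU hV)
    linarith
  have gap : ∀ {u v}, IsRealGap (K ∩ Set.Icc b' c') u v → IsRealGap K u v := by
    intro u v hg
    refine ⟨hg.lt, hg.left_mem.1, hg.right_mem.1, fun z hz => ?_⟩
    rcases lt_or_ge z b' with hzb | hzb
    · exact Or.inl (hzb.le.trans hg.left_mem.2.1)
    rcases lt_or_ge c' z with hzc | hzc
    · exact Or.inr (hg.right_mem.2.2.trans hzc.le)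
    · exact hg.le_or_le z ⟨hz, hzb, hzc⟩
  have hb' : b' ∈ K ∩ Set.Icc b' c' := ⟨hbK, le_rfl, hbc'⟩
  have hc' : c' ∈ K ∩ Set.Icc b' c' := ⟨hcK, hbc', le_rfl⟩
  refine ⟨K ∩ Set.Icc b' c', Set.inter_subset_inter_right _ (Set.Icc_subset_Icc ?_ ?_),
    hK.inter_right isClosed_Icc, ⟨b', hb', c', hc', hlt.ne⟩, ?_, ?_, ?_⟩
  · linarith
  · linarith
  · exact fun u v w z huv hwz hvw => h.sep _ _ _ _ (gap huv) (gap hwz) hvw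
  · intro u v huv
    have hl := huv.left_mem.2.1
    have hr := huv.right_mem.2.2
    refine ⟨b', hb', ?_⟩
    have h3 := h.sep _ _ _ _ gU (gap huv) hl
    have h4 := hmax' (gap huv) gV (by linarith) hr her'
    rw [min_eq_right (le_of_mul_le_mul_right h4 hV)] at h3
    linarith
  · intro u v huv
    have hl := huv.left_mem.2.1
    have hr := huv.right_mem.2.2
    refine ⟨c', hc', ?_⟩
    have h3 := h.sep _ _ _ _ (gap huv) gV hr
    have h4 := hmax' gU (gap huv) hla' hl (by linarith)
    rw [min_eq_left (le_of_mul_le_mul_left h4 hU)] at h3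
    linarith

/-- Points of `K` accumulate at `a` from the left, and `K` contains no interval, so two successive
gaps fit just left of `a`. -/
theorem IsThick.exists_piece_left {K : Set ℝ} {τ : ℝ} (hK : IsCompact K) (h : IsThick K τ)
    (hτ : 0 < τ) (hint : interior K = ∅) {a b : ℝ} (hab : IsRealGap K a b) {ε : ℝ}
    (hε : 0 < ε) :
    ∃ L ⊆ K ∩ Set.Icc (a - ε) (a + ε), IsCompact L ∧ L.Nontrivial ∧ IsThick L τ := by
  obtain ⟨z, hz, hz1, hz2⟩ := h.exists_mem_Ioo_left hK hτ hab hε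
  obtain ⟨a₁, b₁, hg₁, h1, h2⟩ := exists_isRealGap_of_interior_eq_empty hK hint hz
    hab.left_mem hz2
  obtain ⟨w, hw, hw1, hw2⟩ := h.exists_mem_Ioo_left hK hτ hg₁
    (show 0 < a₁ - (a - ε) by linarith)
  obtain ⟨a₂, b₂, hg₂, h3, h4⟩ := exists_isRealGap_of_interior_eq_empty hK hint hw
    hg₁.left_mem hw2
  exact h.exists_piece_of_gaps hK hτ hg₂ hg₁ (by linarith) h4 (by linarith)

theorem interior_neg_image_eq_empty {K : Set ℝ} (hint : interior K = ∅) :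
    interior (Neg.neg '' K) = ∅ := by
  have := (Homeomorph.neg ℝ).image_interior K
  rw [hint, Set.image_empty] at this
  exact this.symm

/-- A thick set without interior has small thick pieces away from a given point. -/
theorem IsThick.exists_piece {K : Set ℝ} {τ : ℝ} (hK : IsCompact K) (h : IsThick K τ)
    (hτ : 0 < τ) (hint : interior K = ∅) {a b : ℝ} (hab : IsRealGap K a b) (x : ℝ) :
    ∃ y, y ≠ x ∧ ∀ ε > 0,
      ∃ L ⊆ K ∩ Set.Icc (y - ε) (y + ε), IsCompact L ∧ L.Nontrivial ∧ IsThick L τ := by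
  -- Either end of the gap would serve, and at least one differs from `x`. The centre is fixed
  -- before `ε`, so that `ε` may later depend on its distance to `x`.
  by_cases hax : a = x
  · refine ⟨b, by linarith [hab.lt] |> fun h : x < b => h.ne', fun ε hε => ?_⟩
    obtain ⟨L, hL, h1, h2, h3⟩ := h.neg.exists_piece_left (hK.image continuous_neg) hτ
      (interior_neg_image_eq_empty hint) hab.neg hε
    refine ⟨Neg.neg '' L, ?_, h1.image continuous_neg, h2.image neg_injective, h3.neg⟩
    rintro _ ⟨z, hz, rfl⟩
    obtain ⟨⟨w, hw, rfl⟩, hz1, hz2⟩ := hL hz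
    exact ⟨by simpa using hw, by linarith, by linarith⟩
  · exact ⟨a, hax, fun ε hε => h.exists_piece_left hK hτ hint hab hε⟩

/-- Thickness under squaring the distance to a point on the left. -/
theorem IsThick.image_sq_sub {L : Set ℝ} {τ τ' x l r : ℝ} (h : IsThick L τ)
    (hL : L ⊆ Set.Icc l r) (hxl : x < l) (hτ' : 0 ≤ τ') (hr : (r - x) * τ' ≤ (l - x) * τ) :
    IsThick ((fun y => (y - x) ^ 2) '' L) τ' := by
  -- The constants are the extreme values on `[l, r]` of the derivative `2 * (y - x)`.
  refine h.image (m := 2 * (l - x)) (M := 2 * (r - x)) (by linarith) hτ' (by linarith) _ ?_ ?_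
  · intro u hu v hv huv
    have hu' := (hL hu).1
    nlinarith [mul_nonneg (sub_nonneg.2 huv) (by linarith : 0 ≤ (u - l) + (v - l))]
  · intro u hu v hv huv
    have hv' := (hL hv).2
    nlinarith [mul_nonneg (sub_nonneg.2 huv) (by linarith : 0 ≤ (r - u) + (r - v))]

/-- The set of squared distances from a point to a thick set contains an almost as thick set. -/
theorem IsThick.exists_subset_sq_sub {K : Set ℝ} {τ τ' : ℝ} (hK : IsCompact K)
    (h : IsThick K τ) (hτ' : 0 < τ') (hττ' : τ' < τ) (hint : interior K = ∅) {a b : ℝ}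
    (hab : IsRealGap K a b) (x : ℝ) :
    ∃ L ⊆ (fun y => (y - x) ^ 2) '' K, IsCompact L ∧ L.Nontrivial ∧ IsThick L τ' := by
  obtain ⟨y, hyx, hy⟩ := h.exists_piece hK (hτ'.trans hττ') hint hab x
  have hD : 0 < |y - x| := abs_pos.2 (sub_ne_zero.2 hyx)
  set D := |y - x| with hDdef
  -- This radius solves `(D + ε) * τ' = (D - ε) * τ`, the largest distortion that the loss from `τ`
  -- to `τ'` allows.
  have hε : 0 < D * ((τ - τ') / (τ + τ')) :=
    mul_pos hD (div_pos (by linarith) (by linarith))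
  set ε := D * ((τ - τ') / (τ + τ')) with hεdef
  have hε1 : ε * (τ + τ') = D * (τ - τ') := by
    rw [hεdef, mul_assoc, div_mul_cancel₀ _ (by linarith)]
  have hεD : ε < D := by
    by_contra! hcon
    nlinarith
  obtain ⟨L, hL, hLc, hLn, hLt⟩ := hy ε hε
  have hr : (D + ε) * τ' ≤ (D - ε) * τ := by linarith
  have hcont : IsCompact ((fun y => (y - x) ^ 2) '' L) := hLc.image (by fun_prop)
  have hLK : L ⊆ K := fun z hz => (hL hz).1
  rcases lt_or_gt_of_ne hyx with hlt | hgt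
  · have hDeq : D = x - y := by rw [hDdef, abs_of_neg (by linarith)]; ring
    have himage : (fun y => (y - x) ^ 2) '' L = (fun y => (y - -x) ^ 2) '' (Neg.neg '' L) := by
      rw [Set.image_image]
      exact Set.image_congr fun z _ => by ring
    refine ⟨_, Set.image_mono hLK, hcont, hLn.image_of_injOn ?_, ?_⟩
    · intro u hu v hv huv
      have h1 := (hL hu).2.2
      have h2 := (hL hv).2.2
      simp only at huv
      have : (u - v) * (u + v - 2 * x) = 0 := by linarith
      rcases mul_eq_zero.1 this with h | h <;> linarith
    · rw [himage]
      refine hLt.neg.image_sq_sub (l := -y - ε) (r := -y + ε) ?_ (by linarith) hτ'.le ?_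
      · rintro _ ⟨z, hz, rfl⟩
        have := (hL hz).2
        exact ⟨by linarith [this.2], by linarith [this.1]⟩
      · rw [hDeq] at hr
        linarith
  · have hDeq : D = y - x := by rw [hDdef, abs_of_pos (by linarith)]
    refine ⟨_, Set.image_mono hLK, hcont, hLn.image_of_injOn ?_, ?_⟩
    · intro u hu v hv huv
      have h1 := (hL hu).2.1
      have h2 := (hL hv).2.1
      simp only at huv
      have : (u - v) * (u + v - 2 * x) = 0 := by linarith
      rcases mul_eq_zero.1 this with h | h <;> linarith
    · refine hLt.image_sq_sub (l := y - ε) (r := y + ε) (fun z hz => (hL hz).2) (by linarith)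
        hτ'.le ?_
      rw [hDeq] at hr
      linarith

/-! ### Distances from a single factor. -/

/-- Along the ray from `x` through an interior point `p ≠ x`, every distance near `‖p - x‖` is
attained in `C`. -/
theorem interior_pinnedDistanceSet_nonempty_of_interior {d : ℕ} (hd : 1 ≤ d)
    {C : Set (EuclideanSpace ℝ (Fin d))} (hC : (interior C).Nonempty)
    (x : EuclideanSpace ℝ (Fin d)) : (interior (pinnedDistanceSet x C)).Nonempty := by
  have : Nonempty (Fin d) := ⟨⟨0, hd⟩⟩
  obtain ⟨p, hp, hpx⟩ : ∃ p ∈ interior C, p ≠ x := by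
    obtain ⟨q, hq⟩ := hC
    exact (infinite_of_mem_nhds q (isOpen_interior.mem_nhds hq)).nontrivial.exists_ne x
  have hpos : 0 < ‖p - x‖ := norm_pos_iff.2 (sub_ne_zero.2 hpx)
  refine ⟨‖p - x‖, mem_interior_iff_mem_nhds.2 ?_⟩
  have hcont : Continuous fun t : ℝ => x + (t / ‖p - x‖) • (p - x) := by fun_prop
  have hmem : x + (‖p - x‖ / ‖p - x‖) • (p - x) ∈ interior C := by
    rw [div_self hpos.ne', one_smul, add_sub_cancel]
    exact hp
  filter_upwards [hcont.continuousAt.preimage_mem_nhds (isOpen_interior.mem_nhds hmem),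
    lt_mem_nhds hpos] with t ht ht0
  refine ⟨_, interior_subset ht, ?_⟩
  rw [sub_add_cancel_left, norm_neg, norm_smul, norm_div, norm_norm, div_mul_cancel₀ _ hpos.ne',
    Real.norm_of_nonneg ht0.le]

/-- In dimension at least two, the pinned distance set of a compact set with a bounded gap and
positive thickness has interior. -/
theorem interior_pinnedDistanceSet_nonempty_of_gapRatioInf {d : ℕ} (hd : 2 ≤ d)
    {C : Set (EuclideanSpace ℝ (Fin d))} (hC : IsCompact C) (hgap : (boundedGaps C).Nonempty)
    (hτ : 0 < gapRatioInf C) (x : EuclideanSpace ℝ (Fin d)) :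
    (interior (pinnedDistanceSet x C)).Nonempty := by
  have : Nonempty (Fin d) := ⟨⟨0, by omega⟩⟩
  obtain ⟨G, hG⟩ := hgap
  obtain ⟨⟨p, hp, hGp⟩, hGb⟩ := hG
  have hGo : IsOpen G := hGp ▸ hC.isClosed.isOpen_compl.pathComponentIn p
  have hpG : p ∈ G := hGp ▸ mem_pathComponentIn_self hp
  -- A point of the closure of `G` farthest from `x`; the distances found are those just above `dist
  -- x q`.
  obtain ⟨q, hq, hmax⟩ := hGb.isCompact_closure.exists_isMaxOn (f := fun y => dist x y)
    ⟨p, subset_closure hpG⟩ (by fun_prop)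
  have hmax' : ∀ y ∈ G, dist x y ≤ dist x q := fun y hy => hmax (subset_closure hy)
  have hs : 0 < dist x q := by
    obtain ⟨y, hy, hyx⟩ := (infinite_of_mem_nhds p (hGo.mem_nhds hpG)).nontrivial.exists_ne x
    exact (dist_pos.2 hyx.symm).trans_le (hmax' y hy)
  have hd0 : Metric.ediam G ≠ ⊤ := Metric.isBounded_iff_ediam_ne_top.1 hGb
  have hdpos : 0 < Metric.ediam G := by
    rw [Metric.ediam_pos_iff]
    exact (infinite_of_mem_nhds p (hGo.mem_nhds hpG)).nontrivial
  set B := (⋃ H ∈ {H ∈ boundedGaps C | H ≠ G ∧ Metric.ediam G ≤ Metric.ediam H}, H) ∪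
    unboundedGap C with hB
  have hdist : 0 < setDist G B := by
    have h1 : gapRatioInf C ≤ setDist G B / Metric.ediam G := iInf₂_le G ⟨⟨p, hp, hGp⟩, hGb⟩
    by_contra! hcon
    rw [nonpos_iff_eq_zero.1 hcon, ENNReal.zero_div] at h1
    exact absurd hτ (not_lt.2 h1)
  obtain ⟨δ, hδ0, hδ⟩ := ENNReal.lt_iff_exists_nnreal_btwn.1 hdist
  have hδ0' : (0 : ℝ) < δ := by exact_mod_cast hδ0
  -- every point of the closure of `G` is far from `B`
  have hfar : ∀ y ∈ B, (δ : ℝ) ≤ dist q y := by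
    intro y hy
    have : closure G ⊆ {z | (δ : ℝ) ≤ dist z y} := by
      refine closure_minimal (fun z hz => ?_) (isClosed_le (by fun_prop) (by fun_prop))
      have h1 : (δ : ℝ≥0∞) ≤ edist z y := hδ.le.trans ((iInf₂_le z hz).trans (iInf₂_le y hy))
      rw [edist_nndist, ENNReal.coe_le_coe] at h1
      exact h1
    exact this hq
  have hsub : Set.Ioo (dist x q) (dist x q + δ) ⊆ pinnedDistanceSet x C := by
    rintro r ⟨hr1, hr2⟩
    by_contra hr
    have hr0 : 0 < r := hs.trans hr1
    have hsph : Metric.sphere x r ⊆ Cᶜ := by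
      intro y hy hyC
      refine hr ⟨y, hyC, ?_⟩
      rw [← dist_eq_norm, dist_comm]
      exact (Metric.mem_sphere.1 hy).symm
    have hrank : 1 < Module.rank ℝ (EuclideanSpace ℝ (Fin d)) := by
      rw [← Module.finrank_eq_rank, finrank_euclideanSpace_fin]
      exact_mod_cast hd
    have hpc := isPathConnected_sphere hrank x hr0.le
    -- The radial projection of `q` to the sphere, at distance `r - dist x q < δ` from `q`. If the
    -- sphere misses `C`, its component puts `y` in `B`, which `hfar` forbids.
    set y := x + (r / dist x q) • (q - x) with hy
    have hnq : ‖q - x‖ = dist x q := by rw [dist_comm, dist_eq_norm]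
    have hyS : y ∈ Metric.sphere x r := by
      rw [mem_sphere_iff_norm, hy, add_sub_cancel_left, norm_smul, hnq, norm_div,
        Real.norm_of_nonneg hr0.le, Real.norm_of_nonneg hs.le, div_mul_cancel₀ _ hs.ne']
    have hqy : dist q y < δ := by
      have : y - q = (r / dist x q - 1) • (q - x) := by
        rw [hy, sub_smul, one_smul]; abel
      rw [dist_comm, dist_eq_norm, this, norm_smul, hnq,
        Real.norm_of_nonneg (by rw [sub_nonneg, one_le_div hs]; exact hr1.le), sub_mul,
        div_mul_cancel₀ _ hs.ne']
      linarith
    have hSsub := hpc.subset_pathComponentIn hyS hsph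
    refine absurd (hfar y ?_) (not_le.2 hqy)
    by_cases hbd : Bornology.IsBounded (pathComponentIn Cᶜ y)
    · refine Or.inl (Set.mem_biUnion (x := pathComponentIn Cᶜ y)
        ⟨⟨⟨y, hsph hyS, rfl⟩, hbd⟩, ?_, ?_⟩ (hSsub hyS))
      · intro heq
        have := hmax' y (heq ▸ hSsub hyS)
        rw [dist_comm, Metric.mem_sphere.1 hyS] at this
        linarith
      · -- the sphere contains antipodal points
        have h1 : Metric.ediam G ≤ ENNReal.ofReal (2 * r) := by
          refine Metric.ediam_le fun u hu v hv => ?_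
          rw [edist_dist]
          refine ENNReal.ofReal_le_ofReal ?_
          have h2 := hmax' u hu
          have h3 := hmax' v hv
          have h4 := dist_triangle_left u v x
          linarith
        have hzS : x - (y - x) ∈ Metric.sphere x r := by
          rw [mem_sphere_iff_norm, sub_sub_cancel_left, norm_neg]
          exact mem_sphere_iff_norm.1 hyS
        refine h1.trans ?_
        refine le_trans (le_of_eq ?_) (Metric.edist_le_ediam_of_mem (hSsub hyS) (hSsub hzS))
        have h5 : y - (x - (y - x)) = (2 : ℝ) • (y - x) := by
          rw [two_smul]; abel
        rw [edist_dist, dist_eq_norm, h5, norm_smul, mem_sphere_iff_norm.1 hyS]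
        norm_num
    · exact Or.inr ⟨hsph hyS, hbd⟩
  exact (Set.nonempty_Ioo.2 (by linarith)).mono (interior_maximal hsub isOpen_Ioo)

/-- Freezing the second coordinate at that of `x` leaves only the distance in the first factor. -/
theorem pinnedDistanceSet_fst_subset {d : ℕ} {C₁ C₂ : Set (EuclideanSpace ℝ (Fin d))}
    (x : WithLp 2 (EuclideanSpace ℝ (Fin d) × EuclideanSpace ℝ (Fin d))) (hx : x.snd ∈ C₂) :
    pinnedDistanceSet x.fst C₁ ⊆ pinnedDistanceSet x (euclideanProd C₁ C₂) := by
  rintro t ⟨y, hy, rfl⟩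
  refine ⟨WithLp.toLp 2 (y, x.snd), ⟨hy, hx⟩, ?_⟩
  simp [WithLp.prod_norm_eq_of_L2]

theorem pinnedDistanceSet_snd_subset {d : ℕ} {C₁ C₂ : Set (EuclideanSpace ℝ (Fin d))}
    (x : WithLp 2 (EuclideanSpace ℝ (Fin d) × EuclideanSpace ℝ (Fin d))) (hx : x.fst ∈ C₁) :
    pinnedDistanceSet x.snd C₂ ⊆ pinnedDistanceSet x (euclideanProd C₁ C₂) := by
  rintro t ⟨y, hy, rfl⟩
  refine ⟨WithLp.toLp 2 (x.fst, y), ⟨hx, hy⟩, ?_⟩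
  simp [WithLp.prod_norm_eq_of_L2]

/-- Finite thresholds even when a factor is infinite; the slack from `s'` to `s` and from `t'` to
`t` is what squaring the distances consumes. -/
theorem ENNReal.exists_lt_lt_of_one_lt_mul {a b : ℝ≥0∞} (h : 1 < a * b) :
    ∃ s s' t t' : ℝ, 0 < s ∧ s < s' ∧ 0 < t ∧ t < t' ∧ 1 < s * t ∧ ENNReal.ofReal s' ≤ a ∧
      ENNReal.ofReal t' ≤ b := by
  obtain ⟨s, h1, h2⟩ := ENNReal.lt_iff_exists_nnreal_btwn.1 (ENNReal.div_lt_of_lt_mul h)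
  obtain ⟨s', h3, h4⟩ := ENNReal.lt_iff_exists_nnreal_btwn.1 h2
  have hs : (0 : ℝ≥0∞) < s := pos_of_gt h1
  have h5 : 1 < (s : ℝ≥0∞) * b := by
    rwa [ENNReal.div_lt_iff (Or.inr one_ne_zero) (Or.inr one_ne_top)] at h1
  obtain ⟨t, h6, h7⟩ := ENNReal.lt_iff_exists_nnreal_btwn.1 (ENNReal.div_lt_of_lt_mul' h5)
  obtain ⟨t', h8, h9⟩ := ENNReal.lt_iff_exists_nnreal_btwn.1 h7
  have ht : (0 : ℝ≥0∞) < t := pos_of_gt h6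
  have h10 : 1 < (s : ℝ≥0∞) * t := by
    rwa [ENNReal.div_lt_iff (Or.inl hs.ne') (Or.inl ENNReal.coe_ne_top), mul_comm] at h6
  refine ⟨s, s', t, t', by exact_mod_cast hs, by exact_mod_cast h3, by exact_mod_cast ht,
    by exact_mod_cast h8, by exact_mod_cast h10, ?_, ?_⟩
  · rw [ENNReal.ofReal_coe_nnreal]; exact h4.le
  · rw [ENNReal.ofReal_coe_nnreal]; exact h9.le

/-! ### From the one-dimensional Euclidean space to the reals. -/

/-- The isometry between the real line and the one-dimensional Euclidean space. -/
noncomputable def lineIsometry : ℝ ≃ₗᵢ[ℝ] EuclideanSpace ℝ (Fin 1) :=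
  (OrthonormalBasis.singleton (Fin 1) ℝ).repr

theorem IsRealGap.pathComponentIn_eq {C : Set (EuclideanSpace ℝ (Fin 1))} {a b p : ℝ}
    (h : IsRealGap (lineIsometry ⁻¹' C) a b) (hp : p ∈ Set.Ioo a b) :
    pathComponentIn Cᶜ (lineIsometry p) = lineIsometry '' Set.Ioo a b := by
  have hsub : lineIsometry '' Set.Ioo a b ⊆ Cᶜ := by
    rintro _ ⟨z, hz, rfl⟩ hzC
    rcases h.le_or_le z hzC with h1 | h1
    · exact not_lt.2 h1 hz.1
    · exact not_lt.2 h1 hz.2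
  apply Set.Subset.antisymm
  · intro z hz
    obtain ⟨z, rfl⟩ := lineIsometry.surjective z
    have hconn : (lineIsometry.symm '' pathComponentIn Cᶜ (lineIsometry p)).OrdConnected :=
      ((isPathConnected_pathComponentIn (hsub ⟨p, hp, rfl⟩)).image
        lineIsometry.symm.continuous).isConnected.isPreconnected.ordConnected
    have hzm : z ∈ lineIsometry.symm '' pathComponentIn Cᶜ (lineIsometry p) :=
      ⟨_, hz, lineIsometry.symm_apply_apply z⟩
    have hpm : p ∈ lineIsometry.symm '' pathComponentIn Cᶜ (lineIsometry p) :=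
      ⟨_, mem_pathComponentIn_self (hsub ⟨p, hp, rfl⟩), lineIsometry.symm_apply_apply p⟩
    have hnot : ∀ w ∈ lineIsometry ⁻¹' C,
        w ∉ lineIsometry.symm '' pathComponentIn Cᶜ (lineIsometry p) := by
      rintro _ hw ⟨w, hw', rfl⟩
      rw [Set.mem_preimage, lineIsometry.apply_symm_apply] at hw
      exact pathComponentIn_subset hw' hw
    refine ⟨z, ⟨?_, ?_⟩, rfl⟩
    · by_contra! hcon
      exact hnot a h.left_mem (hconn.out hzm hpm ⟨hcon, hp.1.le⟩)
    · by_contra! hcon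
      exact hnot b h.right_mem (hconn.out hpm hzm ⟨hp.2.le, hcon⟩)
  · exact (((convex_Ioo a b).isPathConnected ⟨p, hp⟩).image
      lineIsometry.continuous).subset_pathComponentIn ⟨p, hp, rfl⟩ hsub

theorem IsRealGap.image_mem_boundedGaps {C : Set (EuclideanSpace ℝ (Fin 1))} {a b : ℝ}
    (h : IsRealGap (lineIsometry ⁻¹' C) a b) : lineIsometry '' Set.Ioo a b ∈ boundedGaps C := by
  have hp : (a + b) / 2 ∈ Set.Ioo a b := ⟨by linarith [h.lt], by linarith [h.lt]⟩
  have heq := h.pathComponentIn_eq hp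
  refine ⟨⟨_, ?_, heq.symm⟩, lineIsometry.lipschitz.isBounded_image (Metric.isBounded_Ioo a b)⟩
  rw [← pathComponentIn_nonempty_iff, heq]
  exact ⟨_, _, hp, rfl⟩

theorem ediam_lineIsometry_image_Ioo {a b : ℝ} :
    Metric.ediam (lineIsometry '' Set.Ioo a b) = ENNReal.ofReal (b - a) := by
  rw [lineIsometry.isometry.ediam_image, Real.ediam_Ioo]

/-- A convex set avoiding `C` lies in one path component. It is applied to half-lines. -/
theorem image_subset_unboundedGap {C : Set (EuclideanSpace ℝ (Fin 1))} {s : Set ℝ}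
    (hs : Convex ℝ s) (hb : ¬ Bornology.IsBounded s)
    (hsC : Disjoint s (lineIsometry ⁻¹' C)) : lineIsometry '' s ⊆ unboundedGap C := by
  have hsub : lineIsometry '' s ⊆ Cᶜ := by
    rintro _ ⟨z, hz, rfl⟩ hzC
    exact Set.disjoint_left.1 hsC hz hzC
  rintro _ ⟨z, hz, rfl⟩
  refine ⟨hsub ⟨z, hz, rfl⟩, fun hbd => hb ?_⟩
  have h1 := hbd.subset (((hs.isPathConnected ⟨z, hz⟩).image
    lineIsometry.continuous).subset_pathComponentIn ⟨z, hz, rfl⟩ hsub)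
  have h2 := lineIsometry.symm.lipschitz.isBounded_image h1
  rwa [Set.image_image, Set.image_congr fun z _ => lineIsometry.symm_apply_apply z,
    Set.image_id'] at h2

theorem IsRealGap.mul_le_abs_sub {C : Set (EuclideanSpace ℝ (Fin 1))} {τ a b p q : ℝ}
    (hτ : 0 ≤ τ) (hC : ENNReal.ofReal τ ≤ gapRatioInf C)
    (h : IsRealGap (lineIsometry ⁻¹' C) a b) (hp : p ∈ Set.Ioo a b)
    (hq : lineIsometry q ∈ (⋃ H ∈ {H ∈ boundedGaps C | H ≠ lineIsometry '' Set.Ioo a b ∧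
      Metric.ediam (lineIsometry '' Set.Ioo a b) ≤ Metric.ediam H}, H) ∪ unboundedGap C) :
    τ * (b - a) ≤ |p - q| := by
  have h1 := hC.trans (iInf₂_le _ h.image_mem_boundedGaps)
  have hpos : 0 < b - a := sub_pos.2 h.lt
  rw [ediam_lineIsometry_image_Ioo,
    ENNReal.le_div_iff_mul_le (Or.inl (by simpa using h.lt)) (Or.inl ENNReal.ofReal_ne_top),
    ← ENNReal.ofReal_mul hτ] at h1
  rw [ediam_lineIsometry_image_Ioo] at hq
  have h2 := h1.trans ((iInf₂_le (lineIsometry p) ⟨p, hp, rfl⟩).trans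
    (iInf₂_le (lineIsometry q) hq))
  rw [lineIsometry.isometry.edist_eq, edist_dist, Real.dist_eq,
    ENNReal.ofReal_le_ofReal_iff (abs_nonneg _)] at h2
  exact h2

/-- The coordinate set of a thick compact subset of the one-dimensional Euclidean space. -/
theorem isThick_preimage {C : Set (EuclideanSpace ℝ (Fin 1))} (hC : IsCompact C) {τ : ℝ}
    (hτ : 0 ≤ τ) (h : ENNReal.ofReal τ ≤ gapRatioInf C) : IsThick (lineIsometry ⁻¹' C) τ := by
  have hK : IsCompact (lineIsometry ⁻¹' C) :=
    lineIsometry.toHomeomorph.isClosedEmbedding.isCompact_preimage hC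
  have other : ∀ {a b c e q}, IsRealGap (lineIsometry ⁻¹' C) a b →
      IsRealGap (lineIsometry ⁻¹' C) c e → a ≠ c → b - a ≤ e - c → q ∈ Set.Ioo c e →
      lineIsometry q ∈ (⋃ H ∈ {H ∈ boundedGaps C | H ≠ lineIsometry '' Set.Ioo a b ∧
      Metric.ediam (lineIsometry '' Set.Ioo a b) ≤ Metric.ediam H}, H) ∪ unboundedGap C := by
    intro a b c e q hab hce hac hle hq
    refine Or.inl (Set.mem_biUnion (x := lineIsometry '' Set.Ioo c e)
      ⟨hce.image_mem_boundedGaps, fun heq => hac ?_, ?_⟩ ⟨q, hq, rfl⟩)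
    · have h1 := lineIsometry.injective.image_injective heq
      rw [← csInf_Ioo hab.lt, ← h1, csInf_Ioo hce.lt]
    · rw [ediam_lineIsometry_image_Ioo, ediam_lineIsometry_image_Ioo]
      exact ENNReal.ofReal_le_ofReal hle
  refine ⟨fun a b c e hab hce hbc => ?_, fun a b hab => ?_, fun a b hab => ?_⟩
  · have h1 := hab.lt
    have h2 := hce.lt
    by_contra! hcon
    -- Gaps are open, so test points are taken `η` inside each, at distance `c - b + 2 * η`. The
    -- bound is applied to the shorter gap, since the other one then counts among those of at least
    -- its diameter.
    obtain ⟨η, hη, hη'⟩ : ∃ η > 0, c - b + 2 * η < τ * min (b - a) (e - c) ∧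
        η < b - a ∧ η < e - c := by
      refine ⟨min ((τ * min (b - a) (e - c) - (c - b)) / 3) (min ((b - a) / 2) ((e - c) / 2)),
        lt_min (by linarith) (lt_min (by linarith) (by linarith)), ?_, ?_, ?_⟩
      · have := min_le_left ((τ * min (b - a) (e - c) - (c - b)) / 3)
          (min ((b - a) / 2) ((e - c) / 2))
        linarith
      · have := (min_le_right ((τ * min (b - a) (e - c) - (c - b)) / 3)
          (min ((b - a) / 2) ((e - c) / 2))).trans (min_le_left _ _)
        linarith
      · have := (min_le_right ((τ * min (b - a) (e - c) - (c - b)) / 3)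
          (min ((b - a) / 2) ((e - c) / 2))).trans (min_le_right _ _)
        linarith
    obtain ⟨hη1, hη2, hη3⟩ := hη'
    have hp : b - η ∈ Set.Ioo a b := ⟨by linarith, by linarith⟩
    have hq : c + η ∈ Set.Ioo c e := ⟨by linarith, by linarith⟩
    rcases le_total (b - a) (e - c) with hle | hle
    · have := hab.mul_le_abs_sub hτ h hp (other hab hce (by linarith : a < c).ne hle hq)
      rw [min_eq_left hle] at hη1
      rw [abs_of_neg (by linarith)] at this
      linarith
    · have := hce.mul_le_abs_sub hτ h hq (other hce hab (by linarith : a < c).ne' hle hp)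
      rw [min_eq_right hle] at hη1
      rw [abs_of_pos (by linarith)] at this
      linarith
  · obtain ⟨m, hm, hmin⟩ := hK.exists_isLeast ⟨a, hab.left_mem⟩
    refine ⟨m, hm, ?_⟩
    have hma : m ≤ a := hmin hab.left_mem
    have hunb := image_subset_unboundedGap (convex_Iio m)
      (fun hb => not_bddBelow_Iio m hb.bddBelow)
      (Set.disjoint_left.2 fun z hz hzC => not_lt.2 (hmin hzC) hz)
    refine le_of_forall_pos_le_add fun η hη => ?_
    have hlt := hab.lt
    -- `ζ < b - a` keeps `a + ζ` in the gap, and `2 * ζ < η` absorbs the two shifts.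
    obtain ⟨ζ, hζ, hζ'⟩ := exists_between (lt_min (half_pos hη) (sub_pos.2 hlt))
    obtain ⟨hζ1, hζ2⟩ := lt_min_iff.1 hζ'
    have := hab.mul_le_abs_sub (p := a + ζ) (q := m - ζ) hτ h ⟨by linarith, by linarith⟩
      (Or.inr (hunb ⟨_, (by linarith : m - ζ < m), rfl⟩))
    rw [abs_of_pos (by linarith)] at this
    linarith
  · obtain ⟨m, hm, hmax⟩ := hK.exists_isGreatest ⟨b, hab.right_mem⟩
    refine ⟨m, hm, ?_⟩
    have hma : b ≤ m := hmax hab.right_mem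
    have hunb := image_subset_unboundedGap (convex_Ioi m)
      (fun hb => not_bddAbove_Ioi m hb.bddAbove)
      (Set.disjoint_left.2 fun z hz hzC => not_lt.2 (hmax hzC) hz)
    refine le_of_forall_pos_le_add fun η hη => ?_
    have hlt := hab.lt
    obtain ⟨ζ, hζ, hζ'⟩ := exists_between (lt_min (half_pos hη) (sub_pos.2 hlt))
    obtain ⟨hζ1, hζ2⟩ := lt_min_iff.1 hζ'
    have := hab.mul_le_abs_sub (p := b - ζ) (q := m + ζ) hτ h ⟨by linarith, by linarith⟩
      (Or.inr (hunb ⟨_, (by linarith : m < m + ζ), rfl⟩))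
    rw [abs_of_neg (by linarith)] at this
    linarith

/-- A bounded gap of a subset of the line is an interval between two points of the set. -/
theorem exists_isRealGap_of_boundedGaps_nonempty {C : Set (EuclideanSpace ℝ (Fin 1))}
    (hC : IsCompact C) (h : (boundedGaps C).Nonempty) :
    ∃ a b, IsRealGap (lineIsometry ⁻¹' C) a b := by
  obtain ⟨_, ⟨p, hp, rfl⟩, hb⟩ := h
  obtain ⟨p, rfl⟩ := lineIsometry.surjective p
  have hK : IsCompact (lineIsometry ⁻¹' C) :=
    lineIsometry.toHomeomorph.isClosedEmbedding.isCompact_preimage hC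
  -- An unbounded convex set through `p` that missed `C` would put `p` in the unbounded gap; so `C`
  -- has points on both sides of `p`.
  have key : ∀ s : Set ℝ, Convex ℝ s → ¬ Bornology.IsBounded s → p ∈ s →
      ∃ z ∈ s, z ∈ lineIsometry ⁻¹' C := by
    intro s hs hsb hps
    by_contra! hcon
    exact (image_subset_unboundedGap hs hsb (Set.disjoint_left.2 hcon) ⟨p, hps, rfl⟩).2 hb
  obtain ⟨u, hu, huC⟩ := key _ (convex_Iic p) (fun hb => not_bddBelow_Iic p hb.bddBelow)
    (Set.mem_Iic.2 le_rfl)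
  obtain ⟨v, hv, hvC⟩ := key _ (convex_Ici p) (fun hb => not_bddAbove_Ici p hb.bddAbove)
    (Set.mem_Ici.2 le_rfl)
  obtain ⟨a, b, hg, -⟩ := exists_isRealGap hK huC hvC hp hu hv
  exact ⟨a, b, hg⟩

theorem exists_isThick_subset_sq_dist {C : Set (EuclideanSpace ℝ (Fin 1))} (hC : IsCompact C)
    (hint : interior C = ∅) (hgap : (boundedGaps C).Nonempty) {τ τ' : ℝ} (hτ : 0 < τ)
    (hττ' : τ < τ') (h : ENNReal.ofReal τ' ≤ gapRatioInf C) (x : EuclideanSpace ℝ (Fin 1)) :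
    ∃ L : Set ℝ, (∀ t ∈ L, ∃ y ∈ C, t = ‖x - y‖ ^ 2) ∧ IsCompact L ∧ L.Nontrivial ∧
      IsThick L τ := by
  have hK : IsCompact (lineIsometry ⁻¹' C) :=
    lineIsometry.toHomeomorph.isClosedEmbedding.isCompact_preimage hC
  have hKint : interior (lineIsometry ⁻¹' C) = ∅ := by
    have := lineIsometry.toHomeomorph.preimage_interior C
    rw [hint, Set.preimage_empty] at this
    exact this.symm
  obtain ⟨a, b, hab⟩ := exists_isRealGap_of_boundedGaps_nonempty hC hgap
  obtain ⟨x, rfl⟩ := lineIsometry.surjective x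
  obtain ⟨L, hL, h1, h2, h3⟩ := (isThick_preimage hC (hτ.trans hττ').le h).exists_subset_sq_sub
    hK hτ hττ' hKint hab x
  refine ⟨L, fun t ht => ?_, h1, h2, h3⟩
  obtain ⟨y, hy, rfl⟩ := hL ht
  refine ⟨lineIsometry y, hy, ?_⟩
  rw [← map_sub, lineIsometry.norm_map, Real.norm_eq_abs, sq_abs]
  ring

/-! ### Assembling the theorem. -/

theorem interior_nonempty_of_Ioo_sq {D : Set ℝ} {l r : ℝ} (hl : 0 ≤ l) (hlr : l < r)
    (h : ∀ t, 0 ≤ t → t ^ 2 ∈ Set.Ioo l r → t ∈ D) : (interior D).Nonempty := by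
  refine (Set.nonempty_Ioo.2 (Real.sqrt_lt_sqrt hl hlr)).mono
    (interior_maximal (fun t ht => ?_) isOpen_Ioo)
  have ht0 : 0 ≤ t := (Real.sqrt_nonneg l).trans ht.1.le
  exact h t ht0 ⟨(Real.sqrt_lt' ((Real.sqrt_nonneg l).trans_lt ht.1)).1 ht.1,
    (Real.lt_sqrt ht0).1 ht.2⟩

theorem thickness_eq_gapRatioInf {d : ℕ} {C : Set (EuclideanSpace ℝ (Fin d))}
    (hint : interior C = ∅) (h : thickness C ≠ 0) :
    (boundedGaps C).Nonempty ∧ thickness C = gapRatioInf C := by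
  by_cases hg : (boundedGaps C).Nonempty
  · exact ⟨hg, if_pos hg⟩
  · refine absurd ?_ h
    rw [thickness, if_neg hg, if_neg (by simp [hint])]

theorem mainTheorem3 {d : ℕ} (hd : 1 ≤ d) (C₁ C₂ : Set (EuclideanSpace ℝ (Fin d)))
    (hC₁ : IsCompact C₁) (hC₂ : IsCompact C₂)
    (hτ : 1 < thickness C₁ * thickness C₂)
    (x : WithLp 2 (EuclideanSpace ℝ (Fin d) × EuclideanSpace ℝ (Fin d)))
    (hx : x ∈ euclideanProd C₁ C₂) :
    (interior (pinnedDistanceSet x (euclideanProd C₁ C₂))).Nonempty := by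
  by_cases hi₁ : (interior C₁).Nonempty
  · exact (interior_pinnedDistanceSet_nonempty_of_interior hd hi₁ x.fst).mono
      (interior_mono (pinnedDistanceSet_fst_subset x hx.2))
  by_cases hi₂ : (interior C₂).Nonempty
  · exact (interior_pinnedDistanceSet_nonempty_of_interior hd hi₂ x.snd).mono
      (interior_mono (pinnedDistanceSet_snd_subset x hx.1))
  rw [Set.not_nonempty_iff_eq_empty] at hi₁ hi₂
  -- Because `0 * ∞ = 0`, a product above one forces both thicknesses to be nonzero.
  have h0₁ : thickness C₁ ≠ 0 := fun h => by simp [h] at hτ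
  have h0₂ : thickness C₂ ≠ 0 := fun h => by simp [h] at hτ
  obtain ⟨hg₁, he₁⟩ := thickness_eq_gapRatioInf hi₁ h0₁
  obtain ⟨hg₂, he₂⟩ := thickness_eq_gapRatioInf hi₂ h0₂
  rcases hd.eq_or_lt with rfl | hd2
  · rw [he₁, he₂] at hτ
    obtain ⟨s, s', t, t', hs, hss', ht, htt', hst, hs', ht'⟩ :=
      ENNReal.exists_lt_lt_of_one_lt_mul hτ
    obtain ⟨L₁, hL₁, c₁, n₁, k₁⟩ :=
      exists_isThick_subset_sq_dist hC₁ hi₁ hg₁ hs hss' hs' x.fst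
    obtain ⟨L₂, hL₂, c₂, n₂, k₂⟩ :=
      exists_isThick_subset_sq_dist hC₂ hi₂ hg₂ ht htt' ht' x.snd
    obtain ⟨l, r, hlr, hI⟩ := k₁.exists_Ioo_subset_add c₁ c₂ n₁ n₂ k₂ hs ht hst
    have hsum : ∀ T ∈ Set.Ioo l r, ∃ y ∈ euclideanProd C₁ C₂, ‖x - y‖ ^ 2 = T := by
      intro T hT
      obtain ⟨u, hu, v, hv, rfl⟩ := hI T hT
      obtain ⟨y₁, hy₁, rfl⟩ := hL₁ u hu
      obtain ⟨y₂, hy₂, rfl⟩ := hL₂ v hv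
      refine ⟨WithLp.toLp 2 (y₁, y₂), ⟨hy₁, hy₂⟩, ?_⟩
      rw [WithLp.prod_norm_sq_eq_of_L2]
      rfl
    -- Values in the interval are squares, so its right end is positive and `l` may be raised to
    -- `max l 0` before taking square roots.
    have hr : 0 < r := by
      obtain ⟨y, -, hy⟩ := hsum ((l + r) / 2) ⟨by linarith, by linarith⟩
      have := sq_nonneg ‖x - y‖
      linarith
    refine interior_nonempty_of_Ioo_sq (le_max_right l 0) (max_lt hlr hr) fun t ht0 ht => ?_
    obtain ⟨y, hy, hyt⟩ := hsum _ ⟨(le_max_left l 0).trans_lt ht.1, ht.2⟩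
    exact ⟨y, hy, ((sq_eq_sq₀ (norm_nonneg _) ht0).1 hyt).symm⟩
  · exact (interior_pinnedDistanceSet_nonempty_of_gapRatioInf hd2 hC₁ hg₁
      (he₁ ▸ pos_iff_ne_zero.2 h0₁) x.fst).mono
      (interior_mono (pinnedDistanceSet_fst_subset x hx.2))
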